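/- Let $\overline{\mathbb D}$ be the closed unit disc of $\mathbb C$, let $\overline{\mathbb D}^\infty=\{(z_j)_{j\ge1}: |z_j|\le 1 \text{ for all } j\}$ and $\mathbb T^\infty=\{(z_j)_{j\ge1}: |z_j|=1\text{ for all } j\}$. Let $\mathbb N_0^{(\infty)}$ and $\mathbb Z^{(\infty)}$ denote the sets of finitely supported sequences of nonnegative integers and of integers, and put $z^\alpha=\prod_j z_j^{\alpha_j}$ for $\alpha\in\mathbb N_0^{(\infty)}$. Let $A^+(\mathbb T^\infty)$ be the algebra of functions $f:\overline{\mathbb D}^\infty\to\mathbb C$ of the form $f(z)=\sum_{\alpha\in\mathbb N_0^{(\infty)}}a_\alpha z^\alpha$ with $\|f\|=\sum_\alpha|a_\alpha|<\infty$. Let $\varphi=(\varphi_i)_{i\ge1}:\overline{\mathbb D}^\infty\to\overline{\mathbb D}^\infty$ be a map that induces a composition operator $C_\varphi:A^+(\mathbb T^\infty)\to A^+(\mathbb T^\infty)$, $C_\varphi f=f\circ\varphi$ (that is, $f\circ\varphi\in A^+(\mathbb T^\infty)$ for every $f\in A^+(\mathbb T^\infty)$), and suppose that $\varphi(\mathbb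 T^\infty)\subseteq\mathbb T^\infty$. Then: (a) There are a matrix $A=(a_{ij})_{i,j\ge1}$ with entries in $\mathbb N_0$ and finitely supported rows, and complex numbers $\epsilon_i$ with $|\epsilon_i|=1$, such that $$\varphi_i(z)=\epsilon_i\prod_{j}z_j^{a_{ij}}\qquad\text{for all } i\ge1 \text{ and all } z\in\overline{\mathbb D}^\infty.$$ (b) For every such matrix $A$ and such numbers $\epsilon_i$, $C_\varphi$ is an isometry of $A^+(\mathbb T^\infty)$ if and only if the map $A^*:\mathbb Z^{(\infty)}\to\mathbb Z^{(\infty)}$, $(A^*\alpha)_j=\sum_i a_{ij}\alpha_i$, is injective. -/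

import Mathlib

open MeasureTheory

noncomputable section

/-- The closed polydisc `D̄^∞` in countably many variables. -/
abbrev ClosedPolydisc : Type := ℕ → Metric.closedBall (0 : ℂ) 1

/-- The infinite torus `T^∞`, as a subset of the closed polydisc. -/
def infiniteTorus : Set ClosedPolydisc := {z | ∀ j, ‖(z j : ℂ)‖ = 1}

/-- The monomial `z^α = ∏_j z_j ^ α_j`, for a finitely supported multi-index `α`. -/
def polyMonomial (α : ℕ →₀ ℕ) (z : ClosedPolydisc) : ℂ := α.prod fun j n => (z j : ℂ) ^ n

theorem polyMonomial_add (α β : ℕ →₀ ℕ) (z : ClosedPolydisc) :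
    polyMonomial (α + β) z = polyMonomial α z * polyMonomial β z :=
  Finsupp.prod_add_index' (fun _ => pow_zero _) (fun _ _ _ => pow_add _ _ _)

theorem norm_polyMonomial_le (α : ℕ →₀ ℕ) (z : ClosedPolydisc) : ‖polyMonomial α z‖ ≤ 1 := by
  unfold polyMonomial Finsupp.prod
  rw [norm_prod]
  refine Finset.prod_le_one (fun _ _ => norm_nonneg _) fun j _ => ?_
  rw [norm_pow]
  exact pow_le_one₀ (norm_nonneg _) (mem_closedBall_zero_iff.1 (z j).2)

/-- `f` is the sum, on the closed polydisc, of the absolutely convergent Taylor series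
`∑_α a_α z^α`. -/
def HasWienerExpansion (a : (ℕ →₀ ℕ) → ℂ) (f : ClosedPolydisc → ℂ) : Prop :=
  Summable (fun α => ‖a α‖) ∧ ∀ z, HasSum (fun α => a α * polyMonomial α z) (f z)

namespace HasWienerExpansion

variable {a b : (ℕ →₀ ℕ) → ℂ} {f g : ClosedPolydisc → ℂ}

theorem add (hf : HasWienerExpansion a f) (hg : HasWienerExpansion b g) :
    HasWienerExpansion (a + b) (f + g) := by
  refine ⟨(hf.1.add hg.1).of_nonneg_of_le (fun _ => norm_nonneg _) fun _ => norm_add_le _ _,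
    fun z => ?_⟩
  simpa [add_mul] using (hf.2 z).add (hg.2 z)

theorem smul (c : ℂ) (hf : HasWienerExpansion a f) : HasWienerExpansion (c • a) (c • f) := by
  refine ⟨by simpa using hf.1.mul_left ‖c‖, fun z => ?_⟩
  simpa [mul_assoc] using (hf.2 z).mul_left c

theorem const (c : ℂ) : HasWienerExpansion (Pi.single 0 c) (fun _ => c) := by
  refine ⟨summable_of_ne_finset_zero (s := {0}) fun α hα => by simp_all, fun z => ?_⟩
  convert hasSum_single (0 : ℕ →₀ ℕ) (fun α hα => ?_) using 1
  · simp [polyMonomial]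
  · simp [hα]

theorem summable_mul_monomial (hf : HasWienerExpansion a f) (z : ClosedPolydisc) :
    Summable fun α => ‖a α * polyMonomial α z‖ :=
  hf.1.of_nonneg_of_le (fun _ => norm_nonneg _) fun α => by
    rw [norm_mul]; exact mul_le_of_le_one_right (norm_nonneg _) (norm_polyMonomial_le α z)

theorem mul (hf : HasWienerExpansion a f) (hg : HasWienerExpansion b g) :
    HasWienerExpansion
      (fun α => ∑ p ∈ Finset.HasAntidiagonal.antidiagonal α, a p.1 * b p.2) (f * g) := by
  have key : ∀ z, ∀ α : ℕ →₀ ℕ,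
      (∑ p ∈ Finset.HasAntidiagonal.antidiagonal α, a p.1 * b p.2) * polyMonomial α z
        = ∑ p ∈ Finset.HasAntidiagonal.antidiagonal α,
          (a p.1 * polyMonomial p.1 z) * (b p.2 * polyMonomial p.2 z) := by
    intro z α
    rw [Finset.sum_mul]
    refine Finset.sum_congr rfl fun p hp => ?_
    rw [← Finset.HasAntidiagonal.mem_antidiagonal.1 hp, polyMonomial_add]
    ring
  have h0 : Summable fun p : (ℕ →₀ ℕ) × (ℕ →₀ ℕ) => ‖a p.1‖ * ‖b p.2‖ :=
    Summable.mul_of_nonneg hf.1 hg.1 (fun _ => norm_nonneg _) (fun _ => norm_nonneg _)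
  have hn := summable_sum_mul_antidiagonal_of_summable_mul
    (f := fun α => ‖a α‖) (g := fun β => ‖b β‖) h0
  have h1 : ∀ α : ℕ →₀ ℕ,
      ‖∑ p ∈ Finset.HasAntidiagonal.antidiagonal α, a p.1 * b p.2‖
        ≤ ∑ p ∈ Finset.HasAntidiagonal.antidiagonal α, ‖a p.1‖ * ‖b p.2‖ := by
    intro α
    refine (norm_sum_le _ _).trans (le_of_eq ?_)
    exact Finset.sum_congr rfl fun p _ => norm_mul _ _
  refine ⟨Summable.of_nonneg_of_le (fun _ => norm_nonneg _) h1 hn, fun z => ?_⟩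
  have hs := summable_mul_of_summable_norm (hf.summable_mul_monomial z)
    (hg.summable_mul_monomial z)
  have h2 := (hf.2 z).summable.tsum_mul_tsum_eq_tsum_sum_antidiagonal (hg.2 z).summable hs
  have h3 := (summable_sum_mul_antidiagonal_of_summable_mul
    (f := fun α => a α * polyMonomial α z) (g := fun β => b β * polyMonomial β z) hs).hasSum
  rw [← h2, (hf.2 z).tsum_eq, (hg.2 z).tsum_eq] at h3
  simp only [key]
  exact h3

/-- A point of the compact group `Circle^ℕ`, seen in the closed polydisc. -/
def torusPoint (w : ℕ → Circle) : ClosedPolydisc := fun j =>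
  ⟨(w j : ℂ), mem_closedBall_zero_iff.2 (Circle.norm_coe (w j)).le⟩

theorem polyMonomial_mul_point (α : ℕ →₀ ℕ) (v w : ℕ → Circle) :
    polyMonomial α (torusPoint (v * w))
      = polyMonomial α (torusPoint v) * polyMonomial α (torusPoint w) := by
  simp [polyMonomial, torusPoint, Finsupp.prod, mul_pow, Finset.prod_mul_distrib]

theorem norm_polyMonomial_point (α : ℕ →₀ ℕ) (w : ℕ → Circle) :
    ‖polyMonomial α (torusPoint w)‖ = 1 := by
  simp [polyMonomial, torusPoint, Finsupp.prod, Circle.norm_coe]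

theorem continuous_polyMonomial_point (α : ℕ →₀ ℕ) :
    Continuous fun w => polyMonomial α (torusPoint w) := by
  unfold polyMonomial torusPoint Finsupp.prod
  fun_prop

theorem exists_point_ne {α β : ℕ →₀ ℕ} (h : α ≠ β) :
    ∃ w, polyMonomial α (torusPoint w) ≠ polyMonomial β (torusPoint w) := by
  obtain ⟨j, hj⟩ := DFunLike.ne_iff.1 h
  have ev : ∀ γ : ℕ →₀ ℕ, ∀ u : Circle,
      polyMonomial γ (torusPoint (Function.update 1 j u)) = (u : ℂ) ^ γ j := by
    intro γ u
    unfold polyMonomial torusPoint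
    rw [Finsupp.prod_of_support_subset _ (Finset.subset_insert j _) _ (by simp),
      Finset.prod_eq_single j] <;> simp +contextual [Function.update_of_ne]
  refine ⟨Function.update 1 j (Circle.exp 1), ?_⟩
  rw [ev, ev, Circle.coe_exp, ← Complex.exp_nat_mul, ← Complex.exp_nat_mul]
  intro H
  obtain ⟨n, hn⟩ := Complex.exp_eq_exp_iff_exists_int.1 H
  have hr : (α j : ℝ) = β j + n * (2 * Real.pi) := by
    have := congrArg Complex.im hn
    simpa using this
  rcases eq_or_ne n 0 with rfl | hn0
  · apply hj; exact_mod_cast (by simpa using hr : (α j : ℝ) = β j)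
  · refine (irrational_pi.ratCast_mul (q := 2 * n) (by exact_mod_cast (by omega))).ne_int
      ((α j : ℤ) - β j) ?_
    push_cast
    linarith

/-- An absolutely convergent Taylor series is determined by its sum. -/
theorem coeff_unique (ha : HasWienerExpansion a f) (hb : HasWienerExpansion b f) : a = b := by
  have main : ∀ (c : (ℕ →₀ ℕ) → ℂ), HasWienerExpansion c 0 → c = 0 := by
    intro c hc
    funext α
    let _ : MeasurableSpace (ℕ → Circle) := borel _
    have _ : BorelSpace (ℕ → Circle) := ⟨rfl⟩
    let μ : Measure (ℕ → Circle) := Measure.haar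
    let χ : (ℕ →₀ ℕ) → (ℕ → Circle) → ℂ := fun β w => polyMonomial β (torusPoint w)
    have hχ : ∀ β, Continuous (χ β) := continuous_polyMonomial_point
    have hint : ∀ F : (ℕ → Circle) → ℂ, Continuous F → Integrable F μ := fun F hF =>
      hF.integrable_of_hasCompactSupport (HasCompactSupport.of_compactSpace F)
    have hnχ : ∀ β w, ‖χ β w‖ = 1 := norm_polyMonomial_point
    have horth : ∀ β, β ≠ α → ∫ w, χ β w * (starRingEnd ℂ) (χ α w) ∂μ = 0 := by
      intro β hβ
      obtain ⟨v, hv⟩ := exists_point_ne hβ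
      have hinv := integral_mul_left_eq_self (μ := μ)
        (fun w => χ β w * (starRingEnd ℂ) (χ α w)) v
      have hmul : ∀ w, χ β (v * w) * (starRingEnd ℂ) (χ α (v * w))
          = (χ β v * (starRingEnd ℂ) (χ α v)) * (χ β w * (starRingEnd ℂ) (χ α w)) := by
        intro w
        simp only [χ, polyMonomial_mul_point, map_mul]
        ring
      simp only [hmul] at hinv
      rw [integral_const_mul] at hinv
      by_contra hne
      have h1 := mul_right_cancel₀ hne (hinv.trans (one_mul _).symm)
      apply hv
      have h2 : (starRingEnd ℂ) (χ α v) * χ α v = 1 := by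
        rw [mul_comm, Complex.mul_conj, Complex.normSq_eq_norm_sq, hnχ]; simp
      calc χ β v = χ β v * ((starRingEnd ℂ) (χ α v) * χ α v) := by rw [h2, mul_one]
        _ = χ α v := by rw [← mul_assoc, h1, one_mul]
    have hcont : ∀ β, Continuous fun w => c β * χ β w * (starRingEnd ℂ) (χ α w) := fun β =>
      (continuous_const.mul (hχ β)).mul (Complex.continuous_conj.comp (hχ α))
    have hsum := hasSum_integral_of_summable_integral_norm (μ := μ)
      (F := fun β w => c β * χ β w * (starRingEnd ℂ) (χ α w))
      (fun β => hint _ (hcont β)) (by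
        simp only [norm_mul, hnχ, RCLike.norm_conj, mul_one, integral_const, smul_eq_mul]
        exact hc.1.mul_left _)
    have hz : ∀ w, ∑' β, c β * χ β w * (starRingEnd ℂ) (χ α w) = 0 := fun w => by
      rw [tsum_mul_right, (hc.2 (torusPoint w)).tsum_eq]; simp
    simp only [hz, integral_zero] at hsum
    have hsingle : HasSum (fun β => ∫ w, c β * χ β w * (starRingEnd ℂ) (χ α w) ∂μ)
        (∫ w, c α * χ α w * (starRingEnd ℂ) (χ α w) ∂μ) := by
      refine hasSum_single α fun β hβ => ?_
      simp only [mul_assoc]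
      rw [integral_const_mul, horth β hβ, mul_zero]
    have h0 := hsingle.unique hsum
    have h3 : ∀ w, c α * χ α w * (starRingEnd ℂ) (χ α w) = c α := fun w => by
      rw [mul_assoc, Complex.mul_conj, Complex.normSq_eq_norm_sq, hnχ]; simp
    simp only [h3, integral_const] at h0
    rcases smul_eq_zero.1 h0 with h | h
    · exact absurd h measureReal_univ_pos.ne'
    · exact h
  have := main (a + (-1 : ℂ) • b) (by simpa using ha.add (hb.smul (-1)))
  funext α
  have := congrFun this α
  simpa [← sub_eq_add_neg, sub_eq_zero] using this

end HasWienerExpansion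

/-- The functions on the closed polydisc that are sums of absolutely convergent Taylor series. -/
def wienerSubalgebra : Subalgebra ℂ (ClosedPolydisc → ℂ) where
  carrier := {f | ∃ a, HasWienerExpansion a f}
  mul_mem' := fun ⟨_, ha⟩ ⟨_, hb⟩ => ⟨_, HasWienerExpansion.mul ha hb⟩
  add_mem' := fun ⟨_, ha⟩ ⟨_, hb⟩ => ⟨_, HasWienerExpansion.add ha hb⟩
  algebraMap_mem' := fun c => ⟨_, HasWienerExpansion.const c⟩

/-- The Wiener algebra `A⁺(T^∞)`; a type of its own, so that it carries the norm `∑_α |a_α|` and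
not the topology of pointwise convergence. -/
def WienerAlgebra : Type := wienerSubalgebra

namespace WienerAlgebra

instance : CommRing WienerAlgebra := inferInstanceAs (CommRing wienerSubalgebra)

instance : Algebra ℂ WienerAlgebra := inferInstanceAs (Algebra ℂ wienerSubalgebra)

/-- The function on the closed polydisc underlying an element of the Wiener algebra. -/
def toFun (f : WienerAlgebra) : ClosedPolydisc → ℂ := Subtype.val f

theorem exists_expansion (f : WienerAlgebra) : ∃ a, HasWienerExpansion a f.toFun :=
  Subtype.property f

/-- The Taylor coefficients of an element of the Wiener algebra. -/
def coeff (f : WienerAlgebra) : (ℕ →₀ ℕ) → ℂ := Classical.choose f.exists_expansion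

theorem hasWienerExpansion (f : WienerAlgebra) : HasWienerExpansion f.coeff f.toFun :=
  Classical.choose_spec f.exists_expansion

theorem coeff_eq (f : WienerAlgebra) {a : (ℕ →₀ ℕ) → ℂ} (h : HasWienerExpansion a f.toFun) :
    f.coeff = a :=
  f.hasWienerExpansion.coeff_unique h

theorem coeff_add (f g : WienerAlgebra) : (f + g).coeff = f.coeff + g.coeff :=
  coeff_eq _ (f.hasWienerExpansion.add g.hasWienerExpansion)

theorem coeff_smul (c : ℂ) (f : WienerAlgebra) : (c • f).coeff = c • f.coeff :=
  coeff_eq _ (f.hasWienerExpansion.smul c)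

/-- The norm `‖f‖ = ∑_α |a_α|` of `f = ∑_α a_α z^α`. -/
instance : Norm WienerAlgebra := ⟨fun f => ∑' α, ‖f.coeff α‖⟩

theorem norm_def (f : WienerAlgebra) : ‖f‖ = ∑' α, ‖f.coeff α‖ := rfl

theorem normedSpaceCore : NormedSpace.Core ℂ WienerAlgebra where
  norm_nonneg f := tsum_nonneg fun _ => norm_nonneg _
  norm_smul c f := by simp [norm_def, coeff_smul, tsum_mul_left]
  norm_triangle f g := by
    have hf := f.hasWienerExpansion.1
    have hg := g.hasWienerExpansion.1
    rw [norm_def, norm_def, norm_def, ← hf.tsum_add hg]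
    exact (f + g).hasWienerExpansion.1.tsum_le_tsum
      (fun α => by rw [coeff_add]; exact norm_add_le _ _) (hf.add hg)
  norm_eq_zero_iff f := by
    have hf := f.hasWienerExpansion
    constructor
    · intro h
      have h1 := (hasSum_zero_iff_of_nonneg fun _ => norm_nonneg _).1 
        (by rw [← h]; exact hf.1.hasSum)
      refine Subtype.ext (funext fun z => (hf.2 z).unique ?_)
      have h2 : ∀ α, f.coeff α = 0 := fun α => norm_eq_zero.1 (congrFun h1 α)
      simp only [h2, zero_mul]
      exact hasSum_zero
    · rintro rfl
      have : (0 : WienerAlgebra).coeff = 0 := by simpa using coeff_smul 0 0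
      simp [norm_def, this]

instance : NormedAddCommGroup WienerAlgebra := NormedAddCommGroup.ofCore normedSpaceCore

instance : NormedSpace ℂ WienerAlgebra := NormedSpace.ofCore normedSpaceCore

end WienerAlgebra

/-- The self-map `φ` of the closed polydisc induces a composition operator on `A⁺(T^∞)`:
`f ∘ φ` belongs to `A⁺(T^∞)` for every `f` in `A⁺(T^∞)`. -/
def InducesCompositionOperator (φ : ClosedPolydisc → ClosedPolydisc) : Prop :=
  ∀ f ∈ wienerSubalgebra, f ∘ φ ∈ wienerSubalgebra

/-- The composition operator `C_φ : A⁺(T^∞) → A⁺(T^∞)`, `f ↦ f ∘ φ`. -/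
def compositionOperator (φ : ClosedPolydisc → ClosedPolydisc)
    (hφ : InducesCompositionOperator φ) : WienerAlgebra →ₗ[ℂ] WienerAlgebra where
  toFun f := ⟨f.toFun ∘ φ, hφ f.toFun (Subtype.property f)⟩
  map_add' _ _ := rfl
  map_smul' _ _ := rfl

theorem compositionOperator_toFun (φ : ClosedPolydisc → ClosedPolydisc)
    (hφ : InducesCompositionOperator φ) (f : WienerAlgebra) (z : ClosedPolydisc) :
    (compositionOperator φ hφ f).toFun z = f.toFun (φ z) := rfl

/-- `φ_i(z) = ε_i ∏_j z_j ^ a_ij` on the closed polydisc with complex signs `ε_i`, where `A i` is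
the `i`-th row, finitely supported, of the matrix `(a_ij)` of nonnegative integers. -/
def HasMonomialForm (φ : ClosedPolydisc → ClosedPolydisc) (A : ℕ → ℕ →₀ ℕ) (ε : ℕ → ℂ) : Prop :=
  (∀ i, ‖ε i‖ = 1) ∧ ∀ z i, (φ z i : ℂ) = ε i * (A i).prod fun j n => (z j : ℂ) ^ n

/-- The transpose of a row-finite matrix `A = (a_ij)` acting on finitely supported integer
sequences: `(A* α)_j = ∑_i a_ij α_i`. -/
def transposeAction (A : ℕ → ℕ →₀ ℕ) (α : ℕ →₀ ℤ) : ℕ →₀ ℤ :=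
  α.sum fun i n => n • (A i).mapRange (fun k : ℕ => (k : ℤ)) Nat.cast_zero

theorem transposeAction_apply (A : ℕ → ℕ →₀ ℕ) (α : ℕ →₀ ℤ) (j : ℕ) :
    transposeAction A α j = ∑ i ∈ α.support, (A i j : ℤ) * α i := by
  simp [transposeAction, Finsupp.sum, Finsupp.finsetSum_apply, mul_comm]

end

/-! By the closed graph theorem `C_φ` is bounded, so the powers `φ_i^n`, images of monomials of norm
one, have norms bounded by a constant `C`, while `|φ_i| = 1` on the torus. A Beurling–Helson
argument shows that such a function is a monomial.

In one variable, let `p` be an absolutely convergent power series, unimodular on the circle, whose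
powers have coefficient sums at most `C`. The coefficients of `p^n` have `ℓ²` norm 1 and `ℓ¹` norm
at most `C`, so their `ℓ⁴` norm stays away from 0. By Parseval the sum of their fourth powers is, up
to a constant, the integral over `τ` of `|∫ u_τ^n|²`, where `u_τ(θ) = p(e^{i(θ+τ)}) conj p(e^{iθ})`.
If `p` had two nonzero coefficients, the level sets of `u_τ` would be null for almost every `τ`, and
Wiener's averaging argument would send the Cesàro means of these integrals to 0
(`coeff_eq_zero_or_of_bounded_powers`).

In infinitely many variables this applies to each slice in one coordinate. The slice coefficients
are continuous on the connected group `Circle^ℕ` and have modulus 0 or 1, so each vanishes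
everywhere or nowhere, and only one Taylor coefficient survives
(`exists_eq_monomial_of_bounded_powers`).

For (b), `C_φ` sends `z^α` to a unimodular multiple of `z^{A*α}`: it preserves the `ℓ¹` norm when
these exponents are distinct, and is not injective otherwise. -/

noncomputable section

/-! ### Jensen's inequality and boundary uniqueness. -/

open Filter Topology Metric in
/-- Jensen's inequality at the centre of a disc. -/
theorem log_norm_le_circleAverage {r : ℝ} (hr : 0 < r) {f : ℂ → ℂ}
    (hf : AnalyticOnNhd ℂ f (closedBall 0 r)) (h0 : f 0 ≠ 0) :
    Real.log ‖f 0‖ ≤ Real.circleAverage (fun z => Real.log ‖f z‖) 0 r := by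
  have hr' : |r| = r := abs_of_pos hr
  have hf' : AnalyticOnNhd ℂ f (closedBall 0 |r|) := by rwa [hr']
  have h := hf'.circleAverage_log_norm hr.ne' h0
  rw [h]
  -- The extra term in Jensen's formula sums multiplicity times `log (r / |u|)` over the zeros `u`,
  -- and `|u| ≤ r`.
  refine le_add_of_nonneg_left (finsum_nonneg fun u => ?_)
  by_cases hu : u ∈ closedBall (0 : ℂ) |r|
  · refine mul_nonneg ?_ ?_
    · exact_mod_cast MeromorphicOn.AnalyticOnNhd.divisor_nonneg hf' u
    · rcases eq_or_ne u 0 with rfl | hu0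
      · simp
      · refine Real.log_nonneg ?_
        have : 0 < ‖u‖ := norm_pos_iff.2 hu0
        rw [zero_sub, norm_neg, ← div_eq_mul_inv, one_le_div this]
        simpa [hr'] using hu
  · rw [Function.locallyFinsuppWithin.apply_eq_zero_of_notMem _ hu]
    simp

/-- Lebesgue measure on `(0, 2π]`, which parametrizes the unit circle. -/
abbrev arcMeasure : Measure ℝ := volume.restrict (Set.Ioc 0 (2 * Real.pi))

/-- The point `e^{iθ}` of the unit circle. -/
abbrev circlePoint (θ : ℝ) : ℂ := circleMap 0 1 θ

theorem norm_circlePoint (θ : ℝ) : ‖circlePoint θ‖ = 1 := by simp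

theorem arcMeasure_real_univ : arcMeasure.real Set.univ = 2 * Real.pi := by
  simp [Measure.real, Real.pi_pos.le]

-- If `g 0 ≠ 0`, Jensen bounds the mean of `log |g|` from below on every smaller circle. Near the
-- unit circle `log |g|` is very negative over `E` and at most `log M` elsewhere, which pushes the
-- mean below that bound.
open Filter Topology Metric in
theorem eq_zero_at_center_of_vanish {g : ℂ → ℂ} (hc : ContinuousOn g (closedBall 0 1))
    (ha : AnalyticOnNhd ℂ g (ball 0 1)) {E : Set ℝ} (hE : MeasurableSet E)
    (hμ : arcMeasure E ≠ 0) (hv : ∀ θ ∈ E, g (circlePoint θ) = 0) : g 0 = 0 := by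
  by_contra h0
  obtain ⟨M₀, hM₀⟩ := (isCompact_closedBall (0 : ℂ) 1).exists_bound_of_continuousOn hc
  set M := max 1 M₀
  have hM : ∀ z ∈ closedBall (0 : ℂ) 1, ‖g z‖ ≤ M := fun z hz => (hM₀ z hz).trans (le_max_right _ _)
  have hM1 : 1 ≤ M := le_max_left _ _
  have hlM : 0 ≤ Real.log M := Real.log_nonneg hM1
  set m := arcMeasure.real E
  have hm : 0 < m := ENNReal.toReal_pos hμ (measure_ne_top _ _)
  -- Chosen so that `2π log M - K m` lies below `2π log |g 0|`.
  set K : ℝ := (2 * Real.pi * (Real.log M + |Real.log ‖g 0‖|) + 1) / m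
  have hpi := Real.pi_pos
  have hK : 0 ≤ K := by positivity
  have hKm : K * m = 2 * Real.pi * (Real.log M + |Real.log ‖g 0‖|) + 1 :=
    div_mul_cancel₀ _ hm.ne'
  have huc := (isCompact_closedBall (0 : ℂ) 1).uniformContinuousOn_of_continuous hc
  obtain ⟨δ, hδ, hδ'⟩ := Metric.uniformContinuousOn_iff.1 huc (Real.exp (-K)) (Real.exp_pos _)
  set r := max (1 / 2) (1 - δ / 2)
  have hr0 : 0 < r := lt_of_lt_of_le (by norm_num) (le_max_left _ _)
  have hr1 : r < 1 := max_lt (by norm_num) (by linarith)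
  have hrδ : 1 - r < δ := by have := le_max_right (1 / 2) (1 - δ / 2); linarith
  have har : AnalyticOnNhd ℂ g (closedBall 0 r) := ha.mono (closedBall_subset_ball hr1)
  have hfin : (closedBall (0 : ℂ) r \ g ⁻¹' {0}ᶜ).Finite :=
    (isCompact_closedBall (0 : ℂ) r).finite_sdiff_of_mem_codiscreteWithin
      (har.preimage_zero_mem_codiscreteWithin h0 (by simp [hr0.le])
        (isConnected_closedBall (by simpa using hr0.le)))
  -- Zeros must be discarded: there `Real.log 0 = 0` would break the bound by `-K`.
  have hz : ∀ᵐ θ ∂arcMeasure, g (circleMap 0 r θ) ≠ 0 := by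
    have := (hfin.countable.preimage_circleMap 0 hr0.ne').ae_notMem arcMeasure
    filter_upwards [this] with θ hθ h
    exact hθ (by simp [h, abs_of_pos hr0])
  have hmem : ∀ θ, circleMap 0 r θ ∈ closedBall (0 : ℂ) 1 := fun θ => by
    simp [abs_of_pos hr0, hr1.le]
  have hdist : ∀ θ, dist (circleMap 0 r θ) (circlePoint θ) < δ := fun θ => by
    have : circleMap 0 r θ - circleMap 0 1 θ = ((r - 1 : ℝ) : ℂ) * circleMap 0 1 θ := by
      simp [circleMap]; ring
    rw [dist_eq_norm, this, norm_mul, norm_circlePoint, Complex.norm_real, Real.norm_eq_abs,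
      abs_of_neg (by linarith)]
    linarith
  have hci : CircleIntegrable (fun z => Real.log ‖g z‖) 0 r :=
    MeromorphicOn.circleIntegrable_log_norm
      ((har.mono (by rw [abs_of_pos hr0]; exact sphere_subset_closedBall)).meromorphicOn)
  have hint : Integrable (fun θ => Real.log ‖g (circleMap 0 r θ)‖) arcMeasure :=
    (intervalIntegrable_iff_integrableOn_Ioc_of_le Real.two_pi_pos.le).1 hci
  have hub : ∫ θ, Real.log ‖g (circleMap 0 r θ)‖ ∂arcMeasure
      ≤ ∫ θ, (Real.log M + E.indicator (fun _ => -K) θ) ∂arcMeasure := by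
    refine integral_mono_ae hint
      ((integrable_const _).add ((integrable_const _).indicator hE)) ?_
    filter_upwards [hz] with θ hθ
    have hp : 0 < ‖g (circleMap 0 r θ)‖ := norm_pos_iff.2 hθ
    by_cases hθE : θ ∈ E
    · have h1 := hδ' _ (hmem θ) (circlePoint θ) (by simp) (hdist θ)
      rw [hv θ hθE, dist_zero_right] at h1
      have h2 := Real.log_le_log hp h1.le
      rw [Real.log_exp] at h2
      simp only [hθE, Set.indicator_of_mem]
      linarith
    · simp only [hθE, not_false_eq_true, Set.indicator_of_notMem, add_zero]
      exact Real.log_le_log hp (hM _ (hmem θ))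
  rw [integral_add (integrable_const _) ((integrable_const _).indicator hE),
    integral_indicator_const _ hE, integral_const, arcMeasure_real_univ] at hub
  have hj := log_norm_le_circleAverage hr0 har h0
  rw [Real.circleAverage_def, intervalIntegral.integral_of_le Real.two_pi_pos.le, smul_eq_mul,
    inv_mul_eq_div, le_div_iff₀ Real.two_pi_pos] at hj
  have h3 := hj.trans hub
  change _ ≤ 2 * Real.pi * Real.log M + m * (-K) at h3
  have h4 := neg_abs_le (Real.log ‖g 0‖)
  nlinarith

/-! ### Absolutely convergent power series on the circle: uniqueness and Parseval. -/

/-- The sum of a power series. -/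
def powerSum (p : ℕ → ℂ) (z : ℂ) : ℂ := ∑' k, p k * z ^ k

section PowerSum

variable {p q : ℕ → ℂ}

theorem norm_mul_pow_le (p : ℕ → ℂ) {z : ℂ} (hz : ‖z‖ ≤ 1) (k : ℕ) : ‖p k * z ^ k‖ ≤ ‖p k‖ := by
  rw [norm_mul, norm_pow]
  exact mul_le_of_le_one_right (norm_nonneg _) (pow_le_one₀ (norm_nonneg _) hz)

theorem hasSum_powerSum (hp : Summable fun k => ‖p k‖) {z : ℂ} (hz : ‖z‖ ≤ 1) :
    HasSum (fun k => p k * z ^ k) (powerSum p z) :=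
  (Summable.of_norm_bounded hp (norm_mul_pow_le p hz)).hasSum

theorem continuousOn_powerSum (hp : Summable fun k => ‖p k‖) :
    ContinuousOn (powerSum p) (Metric.closedBall 0 1) :=
  continuousOn_tsum (fun k => by fun_prop) hp fun k z hz =>
    norm_mul_pow_le p (by simpa using hz) k

theorem analyticOnNhd_powerSum (hp : Summable fun k => ‖p k‖) :
    AnalyticOnNhd ℂ (powerSum p) (Metric.ball 0 1) := by
  refine DifferentiableOn.analyticOnNhd ?_ Metric.isOpen_ball
  exact Complex.differentiableOn_tsum_of_summable_norm hp (fun k => by fun_prop)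
    Metric.isOpen_ball fun k z hz => norm_mul_pow_le p (mem_ball_zero_iff.1 hz).le k

theorem continuous_powerSum_comp (hp : Summable fun k => ‖p k‖) {X : Type*} [TopologicalSpace X]
    {w : X → ℂ} (hw : Continuous w) (h1 : ∀ x, ‖w x‖ ≤ 1) : Continuous fun x => powerSum p (w x) :=
  (continuousOn_powerSum hp).comp_continuous hw fun x => by simpa using h1 x

theorem powerSum_zero_right (p : ℕ → ℂ) : powerSum p 0 = p 0 := by
  rw [powerSum, tsum_eq_single 0]
  · simp
  · intro k hk; simp [hk]

theorem powerSum_mul (p : ℕ → ℂ) (z w : ℂ) :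
    powerSum p (z * w) = powerSum (fun k => p k * w ^ k) z := by
  unfold powerSum
  refine tsum_congr fun k => ?_
  rw [mul_pow]; ring

/-- A power series converging absolutely on the closed disc and vanishing on a subset of positive
measure of the circle is zero. -/
theorem eq_zero_of_powerSum_vanish (hp : Summable fun k => ‖p k‖) {E : Set ℝ}
    (hE : MeasurableSet E) (hμ : arcMeasure E ≠ 0)
    (hv : ∀ θ ∈ E, powerSum p (circlePoint θ) = 0) : p = 0 := by
  classical
  by_contra hne
  have hex : ∃ k, p k ≠ 0 := by
    by_contra! h
    exact hne (funext h)
  -- Dividing by `z ^ m` moves the first nonzero coefficient to the centre of the disc.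
  set m := Nat.find hex
  have hm : p m ≠ 0 := Nat.find_spec hex
  have hlt : ∀ k < m, p k = 0 := fun k hk => by simpa using Nat.find_min hex hk
  have hp' : Summable fun k => ‖p (k + m)‖ :=
    (summable_nat_add_iff (f := fun k => ‖p k‖) m).2 hp
  have hs : ∀ z, ‖z‖ ≤ 1 → powerSum p z = z ^ m * powerSum (fun k => p (k + m)) z := by
    intro z hz
    have h1 := (hasSum_powerSum hp hz).summable.sum_add_tsum_nat_add m
    rw [Finset.sum_eq_zero fun k hk => by rw [hlt k (Finset.mem_range.1 hk), zero_mul],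
      zero_add] at h1
    rw [powerSum, ← h1, powerSum, ← tsum_mul_left]
    refine tsum_congr fun k => ?_
    ring
  have h0 := eq_zero_at_center_of_vanish (continuousOn_powerSum hp') (analyticOnNhd_powerSum hp')
    hE hμ fun θ hθ => by
      have h2 := hv θ hθ
      rw [hs _ (norm_circlePoint θ).le] at h2
      refine (mul_eq_zero.1 h2).resolve_left (pow_ne_zero _ ?_)
      rw [← norm_pos_iff, norm_circlePoint]; exact one_pos
  rw [powerSum_zero_right, zero_add] at h0
  exact hm h0

theorem hasSum_integral_powerSum_mul (hp : Summable fun k => ‖p k‖) {w : ℝ → ℂ}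
    (hw : Continuous w) :
    HasSum (fun k => p k * ∫ θ, circlePoint θ ^ k * w θ ∂arcMeasure)
      (∫ θ, powerSum p (circlePoint θ) * w θ ∂arcMeasure) := by
  have hint : ∀ F : ℝ → ℂ, Continuous F → Integrable F arcMeasure := fun F hF =>
    hF.integrableOn_Ioc
  have h := hasSum_integral_of_summable_integral_norm (μ := arcMeasure)
    (F := fun k θ => p k * (circlePoint θ ^ k * w θ))
    (fun k => hint _ (by fun_prop)) (by
      simp only [norm_mul, norm_pow, norm_circlePoint, one_pow, one_mul]
      simp only [integral_const_mul]
      exact hp.mul_right _)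
  simp only [integral_const_mul] at h
  simp only [powerSum, ← tsum_mul_right, mul_assoc]
  exact h

theorem integral_circlePoint_pow_mul_conj (k l : ℕ) :
    ∫ θ, circlePoint θ ^ k * (starRingEnd ℂ) (circlePoint θ ^ l) ∂arcMeasure
      = if k = l then (2 * Real.pi : ℂ) else 0 := by
  have he : ∀ θ : ℝ, circlePoint θ ^ k * (starRingEnd ℂ) (circlePoint θ ^ l)
      = Complex.exp ((((k : ℂ) - l) * Complex.I) * θ) := by
    intro θ
    simp only [circlePoint, circleMap_zero, Complex.ofReal_one, one_mul, map_natCast,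
      ← Complex.exp_conj, ← Complex.exp_nat_mul, ← Complex.exp_add, map_mul, Complex.conj_ofReal,
      Complex.conj_I]
    congr 1
    ring
  simp only [he]
  rw [← intervalIntegral.integral_of_le Real.two_pi_pos.le]
  split_ifs with h
  · simp [h]
  · have hne : ((k : ℂ) - l) ≠ 0 := sub_ne_zero.2 (by exact_mod_cast h)
    rw [integral_exp_mul_complex (mul_ne_zero hne Complex.I_ne_zero)]
    have : (((k : ℂ) - l) * Complex.I) * ((2 * Real.pi : ℝ) : ℂ)
        = ((k - l : ℤ) : ℂ) * (2 * Real.pi * Complex.I) := by push_cast; ring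
    rw [this, Complex.exp_int_mul_two_pi_mul_I]
    simp

theorem integral_powerSum_mul_conj_pow (hp : Summable fun k => ‖p k‖) (l : ℕ) :
    ∫ θ, powerSum p (circlePoint θ) * (starRingEnd ℂ) (circlePoint θ ^ l) ∂arcMeasure
      = 2 * Real.pi * p l := by
  have h := hasSum_integral_powerSum_mul hp
    (w := fun θ => (starRingEnd ℂ) (circlePoint θ ^ l)) (by fun_prop)
  simp only [integral_circlePoint_pow_mul_conj] at h
  refine h.unique ?_
  convert hasSum_single l (fun k hk => ?_) using 1
  · simp [mul_comm]
  · simp [hk]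

/-- Parseval's identity. -/
theorem hasSum_parseval (hp : Summable fun k => ‖p k‖) (hq : Summable fun k => ‖q k‖) :
    HasSum (fun k => p k * (2 * Real.pi * (starRingEnd ℂ) (q k)))
      (∫ θ, powerSum p (circlePoint θ) * (starRingEnd ℂ) (powerSum q (circlePoint θ))
        ∂arcMeasure) := by
  have hc : Continuous fun θ => powerSum q (circlePoint θ) :=
    continuous_powerSum_comp hq (by fun_prop) fun θ => (norm_circlePoint θ).le
  convert hasSum_integral_powerSum_mul hp
    (w := fun θ => (starRingEnd ℂ) (powerSum q (circlePoint θ)))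
    (Complex.continuous_conj.comp hc) using 3 with k
  have := congrArg (starRingEnd ℂ) (integral_powerSum_mul_conj_pow hq k)
  rw [← integral_conj] at this
  simp only [map_mul, Complex.conj_conj, Complex.conj_ofReal] at this
  have h2 : (starRingEnd ℂ) 2 = 2 := Complex.conj_ofNat 2
  rw [h2] at this
  rw [← this]
  refine integral_congr_ae (Filter.Eventually.of_forall fun θ => ?_)
  simp [mul_comm]

theorem hasSum_normSq (hp : Summable fun k => ‖p k‖) :
    HasSum (fun k => 2 * Real.pi * ‖p k‖ ^ 2)
      (∫ θ, ‖powerSum p (circlePoint θ)‖ ^ 2 ∂arcMeasure) := by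
  have h := hasSum_parseval hp hp
  have hI : ∫ θ, powerSum p (circlePoint θ) * (starRingEnd ℂ) (powerSum p (circlePoint θ))
      ∂arcMeasure = ((∫ θ, ‖powerSum p (circlePoint θ)‖ ^ 2 ∂arcMeasure : ℝ) : ℂ) := by
    simp only [Complex.mul_conj', ← Complex.ofReal_pow]
    exact integral_ofReal
  rw [hI] at h
  rw [← Complex.hasSum_ofReal]
  refine h.congr_fun fun k => ?_
  push_cast
  rw [← Complex.mul_conj']
  ring

end PowerSum

/-! ### Fourth powers of coefficients and autocorrelation. -/

/-- Unimodularity makes the `ℓ²` norm 1. Coefficients below `1 / (2C)` carry at most half of the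
square sum, so the large ones carry the rest, and these are controlled by fourth powers. -/
theorem one_div_le_tsum_norm_pow_four {p : ℕ → ℂ} (hp : Summable fun k => ‖p k‖) {C : ℝ}
    (hC0 : 0 < C) (hC : ∑' k, ‖p k‖ ≤ C) (h1 : ∀ θ, ‖powerSum p (circlePoint θ)‖ = 1) :
    1 / (8 * C ^ 2) ≤ ∑' k, ‖p k‖ ^ 4 := by
  have h2 := hasSum_normSq hp
  simp only [h1, one_pow, integral_const, arcMeasure_real_univ, smul_eq_mul] at h2
  have h3 : HasSum (fun k => ‖p k‖ ^ 2) 1 := by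
    rwa [hasSum_mul_left_iff Real.two_pi_pos.ne'] at h2
  have hle : ∀ k, ‖p k‖ ^ 2 ≤ 1 := fun k => by
    rw [← h3.tsum_eq]; exact h3.summable.le_tsum k fun _ _ => by positivity
  have h4 : Summable fun k => ‖p k‖ ^ 4 := by
    refine h3.summable.of_nonneg_of_le (fun k => by positivity) fun k => ?_
    nlinarith [hle k, sq_nonneg ‖p k‖]
  -- The first term alone suffices below the threshold `1 / (2C)`, the second alone above it.
  have hpt : ∀ k, ‖p k‖ ^ 2 ≤ (1 / (2 * C)) * ‖p k‖ + (4 * C ^ 2) * ‖p k‖ ^ 4 := by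
    intro k
    have h0 := norm_nonneg (p k)
    set x := ‖p k‖
    rcases le_total x (1 / (2 * C)) with h | h
    · nlinarith [mul_le_mul_of_nonneg_right h h0, mul_nonneg (sq_nonneg C) (pow_nonneg h0 4)]
    · have h5 : 1 ≤ x * (2 * C) := by rwa [div_le_iff₀ (by positivity)] at h
      have h6 : 1 ≤ (x * (2 * C)) ^ 2 := one_le_pow₀ h5
      have h7 : 0 ≤ (1 / (2 * C)) * x := by positivity
      nlinarith [mul_le_mul_of_nonneg_right h6 (sq_nonneg x)]
  have h5 := h3.summable.tsum_le_tsum hpt ((hp.mul_left _).add (h4.mul_left _))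
  rw [h3.tsum_eq, (hp.mul_left _).tsum_add (h4.mul_left _), tsum_mul_left, tsum_mul_left] at h5
  have h6 : (1 / (2 * C)) * ∑' k, ‖p k‖ ≤ 1 / 2 := by
    calc _ ≤ (1 / (2 * C)) * C := by gcongr
      _ = 1 / 2 := by field_simp
  rw [div_le_iff₀ (by positivity)]
  nlinarith

theorem summable_norm_normSq {p : ℕ → ℂ} (hp : Summable fun k => ‖p k‖) :
    Summable fun k => ‖(‖p k‖ ^ 2 : ℂ)‖ := by
  have h : ∀ k, ‖(‖p k‖ ^ 2 : ℂ)‖ = ‖p k‖ * ‖p k‖ := fun k => by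
    rw [norm_pow, Complex.norm_real, norm_norm, sq]
  simp only [h]
  exact (hp.mul_left (∑' k, ‖p k‖)).of_nonneg_of_le (fun k => by positivity) fun k =>
    mul_le_mul_of_nonneg_right (hp.le_tsum k fun _ _ => norm_nonneg _) (norm_nonneg _)

/-- Rotation by `w` multiplies the `k`-th coefficient by `w ^ k`, so Parseval turns the
autocorrelation into a power series in `w`. -/
theorem integral_powerSum_autocorrelation {p : ℕ → ℂ} (hp : Summable fun k => ‖p k‖) {w : ℂ}
    (hw : ‖w‖ = 1) :
    ∫ θ, powerSum p (circlePoint θ * w) * (starRingEnd ℂ) (powerSum p (circlePoint θ)) ∂arcMeasure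
      = 2 * Real.pi * powerSum (fun k => (‖p k‖ ^ 2 : ℂ)) w := by
  simp only [powerSum_mul]
  have hp' : Summable fun k => ‖p k * w ^ k‖ := by simpa [hw] using hp
  rw [← (hasSum_parseval hp' hp).tsum_eq, powerSum, ← tsum_mul_left]
  refine tsum_congr fun k => ?_
  rw [← Complex.mul_conj']
  ring

/-- A second use of Parseval, now in the rotation variable, expresses the fourth powers through the
moments of `u_τ`. -/
theorem integral_normSq_autocorrelation {p : ℕ → ℂ} (hp : Summable fun k => ‖p k‖) :
    ∫ τ, ‖∫ θ, powerSum p (circlePoint θ * circlePoint τ) *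
      (starRingEnd ℂ) (powerSum p (circlePoint θ)) ∂arcMeasure‖ ^ 2 ∂arcMeasure
      = (2 * Real.pi) ^ 3 * ∑' k, ‖p k‖ ^ 4 := by
  have hq := summable_norm_normSq hp
  simp only [integral_powerSum_autocorrelation hp (norm_circlePoint _), norm_mul, mul_pow]
  rw [integral_const_mul, ← (hasSum_normSq hq).tsum_eq, tsum_mul_left]
  have : ∀ k, ‖(‖p k‖ ^ 2 : ℂ)‖ ^ 2 = ‖p k‖ ^ 4 := fun k => by
    simp only [norm_pow, Complex.norm_real, norm_norm, ← pow_mul]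
  simp only [this]
  simp [abs_of_pos Real.pi_pos]
  ring

/-! ### Wiener's averaging argument. -/

open Filter Topology in
/-- The Cesàro means of the powers of a unimodular number other than `1` tend to `0`. -/
theorem tendsto_average_pow_zero {w : ℂ} (hw : ‖w‖ = 1) (h1 : w ≠ 1) :
    Tendsto (fun N : ℕ => (N : ℂ)⁻¹ * ∑ n ∈ Finset.range N, w ^ n) atTop (𝓝 0) := by
  have hpos : 0 < ‖w - 1‖ := norm_pos_iff.2 (sub_ne_zero.2 h1)
  refine squeeze_zero_norm (a := fun N : ℕ => (2 / ‖w - 1‖) * (N : ℝ)⁻¹) (fun N => ?_) ?_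
  · rw [geom_sum_eq h1, norm_mul, norm_div, norm_inv, Complex.norm_natCast, mul_comm]
    gcongr
    refine (norm_sub_le _ _).trans ?_
    rw [norm_pow, hw]; norm_num
  · simpa using tendsto_natCast_atTop_atTop.inv_tendsto_atTop.const_mul (2 / ‖w - 1‖)

theorem norm_average_le {N : ℕ} {f : ℕ → ℂ} {B : ℝ} (hB : 0 ≤ B) (hf : ∀ n, ‖f n‖ ≤ B) :
    ‖(N : ℂ)⁻¹ * ∑ n ∈ Finset.range N, f n‖ ≤ B := by
  rcases Nat.eq_zero_or_pos N with rfl | hN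
  · simpa using hB
  · have hN' : (0 : ℝ) < N := by exact_mod_cast hN
    rw [norm_mul, norm_inv, Complex.norm_natCast, inv_mul_le_iff₀ hN']
    refine (norm_sum_le _ _).trans ((Finset.sum_le_sum fun n _ => hf n).trans ?_)
    simp

open Filter Topology in
/-- A unimodular function all of whose level sets are null has moments tending to `0` in quadratic
mean. -/
theorem tendsto_average_normSq_integral_pow {X : Type*} [MeasurableSpace X] {μ : Measure X}
    [IsFiniteMeasure μ] {u : X → ℂ} (hu : Measurable u) (h1 : ∀ x, ‖u x‖ = 1)
    (hlev : ∀ y, ∀ᵐ x ∂μ, u x ≠ u y) :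
    Tendsto (fun N : ℕ => (N : ℝ)⁻¹ * ∑ n ∈ Finset.range N, ‖∫ x, u x ^ n ∂μ‖ ^ 2) atTop (𝓝 0) := by
  have hint : ∀ n (v : ℂ), Integrable (fun x => (u x * v) ^ n) μ := fun n v =>
    Integrable.of_bound ((hu.mul_const v).pow_const n).aestronglyMeasurable (‖v‖ ^ n)
      (Eventually.of_forall fun x => by simp [h1])
  have hmul : ∀ n (v : ℂ), ∫ x, (u x * v) ^ n ∂μ = (∫ x, u x ^ n ∂μ) * v ^ n := fun n v => by
    simp only [mul_pow]; exact integral_mul_const _ _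
  -- The squared moment is the double integral of `(u x * conj (u y)) ^ n`. Its Cesàro means tend to
  -- 0 unless `u x = u y`, a null event for each `y`; dominated convergence is applied in `x`, then
  -- in `y`.
  have hinner : ∀ y, Tendsto (fun N : ℕ => ∫ x, (N : ℂ)⁻¹ * ∑ n ∈ Finset.range N,
      (u x * (starRingEnd ℂ) (u y)) ^ n ∂μ) atTop (𝓝 0) := by
    intro y
    have := tendsto_integral_of_dominated_convergence (μ := μ) (fun _ => (1 : ℝ))
      (F := fun (N : ℕ) x => (N : ℂ)⁻¹ * ∑ n ∈ Finset.range N, (u x * (starRingEnd ℂ) (u y)) ^ n)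
      (f := fun _ => 0)
      (fun N => ((Finset.measurable_fun_sum _ fun n _ =>
        (hu.mul_const _).pow_const n).const_mul _).aestronglyMeasurable)
      (integrable_const _)
      (fun N => Eventually.of_forall fun x => norm_average_le zero_le_one fun n => by simp [h1])
      (by
        filter_upwards [hlev y] with x hx
        refine tendsto_average_pow_zero (by simp [h1]) fun h => hx ?_
        have h2 : (starRingEnd ℂ) (u y) * u y = 1 := by
          rw [mul_comm, Complex.mul_conj', h1]; simp
        calc u x = u x * ((starRingEnd ℂ) (u y) * u y) := by rw [h2, mul_one]
          _ = u y := by rw [← mul_assoc, h, one_mul])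
    simpa using this
  have hbd : ∀ n y, ‖∫ x, (u x * (starRingEnd ℂ) (u y)) ^ n ∂μ‖ ≤ μ.real Set.univ := by
    intro n y
    refine (norm_integral_le_of_norm_le_const (C := 1)
      (Eventually.of_forall fun x => by simp [h1])).trans (by simp)
  have hin : ∀ (N : ℕ) y, ∫ x, (N : ℂ)⁻¹ * ∑ n ∈ Finset.range N,
      (u x * (starRingEnd ℂ) (u y)) ^ n ∂μ = (N : ℂ)⁻¹ * ∑ n ∈ Finset.range N,
        ∫ x, (u x * (starRingEnd ℂ) (u y)) ^ n ∂μ := fun N y => by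
    rw [integral_const_mul, integral_finsetSum _ fun n _ => hint n _]
  simp only [hin] at hinner
  have hmeas : ∀ n, Measurable fun y => ∫ x, (u x * (starRingEnd ℂ) (u y)) ^ n ∂μ := fun n => by
    simp only [hmul]
    exact ((Complex.continuous_conj.measurable.comp hu).pow_const n).const_mul _
  have houter := tendsto_integral_of_dominated_convergence (μ := μ) (fun _ => μ.real Set.univ)
    (F := fun (N : ℕ) y => (N : ℂ)⁻¹ * ∑ n ∈ Finset.range N,
      ∫ x, (u x * (starRingEnd ℂ) (u y)) ^ n ∂μ) (f := fun _ => 0)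
    (fun N => ((Finset.measurable_fun_sum _ fun n _ => hmeas n).const_mul _).aestronglyMeasurable)
    (integrable_const _)
    (fun N => Eventually.of_forall fun y => norm_average_le measureReal_nonneg fun n => hbd n y)
    (Eventually.of_forall hinner)
  have hsq : ∀ n, ∫ y, ∫ x, (u x * (starRingEnd ℂ) (u y)) ^ n ∂μ ∂μ
      = ((‖∫ x, u x ^ n ∂μ‖ ^ 2 : ℝ) : ℂ) := fun n => by
    simp only [hmul]
    rw [integral_const_mul]
    simp only [← map_pow]
    rw [integral_conj, Complex.mul_conj']
    push_cast; rfl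
  have hout : ∀ N : ℕ, ∫ y, (N : ℂ)⁻¹ * ∑ n ∈ Finset.range N,
      ∫ x, (u x * (starRingEnd ℂ) (u y)) ^ n ∂μ ∂μ
      = (((N : ℝ)⁻¹ * ∑ n ∈ Finset.range N, ‖∫ x, u x ^ n ∂μ‖ ^ 2 : ℝ) : ℂ) := fun N => by
    rw [integral_const_mul, integral_finsetSum _ fun n _ => Integrable.of_bound
      (hmeas n).aestronglyMeasurable _ (Eventually.of_forall fun y => hbd n y)]
    simp only [hsq]
    push_cast; rfl
  simp only [hout, integral_zero] at houter
  rw [← Complex.ofReal_zero] at houter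
  exact (Complex.continuous_re.tendsto _).comp houter

theorem ae_circlePoint_pow_ne {k l : ℕ} (h : k ≠ l) :
    ∀ᵐ τ ∂arcMeasure, circlePoint τ ^ k ≠ circlePoint τ ^ l := by
  refine ae_restrict_of_ae ?_
  have hcount : (Set.range fun n : ℤ => (n : ℝ) * (2 * Real.pi) / ((k : ℝ) - l)).Countable :=
    Set.countable_range _
  filter_upwards [hcount.ae_notMem volume] with τ hτ he
  apply hτ
  simp only [circlePoint, circleMap_zero, Complex.ofReal_one, one_mul,
    ← Complex.exp_nat_mul] at he
  obtain ⟨n, hn⟩ := Complex.exp_eq_exp_iff_exists_int.1 he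
  refine ⟨n, ?_⟩
  have hr := congrArg Complex.im hn
  simp at hr
  have hne : (k : ℝ) - l ≠ 0 := sub_ne_zero.2 (by exact_mod_cast h)
  simp only
  rw [div_eq_iff hne]
  linarith

/-! ### The Beurling–Helson theorem in one variable. -/

open Filter Topology in
/-- The Beurling–Helson theorem for absolutely convergent power series on the unit circle. -/
theorem coeff_eq_zero_or_of_bounded_powers {c : ℕ → ℕ → ℂ} {C : ℝ}
    (hs : ∀ n, Summable fun k => ‖c n k‖) (hC : ∀ n, ∑' k, ‖c n k‖ ≤ C) {p : ℕ → ℂ}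
    (hp : Summable fun k => ‖p k‖)
    (hpow : ∀ n (z : ℂ), ‖z‖ = 1 → powerSum (c n) z = powerSum p z ^ n)
    (h1 : ∀ z : ℂ, ‖z‖ = 1 → ‖powerSum p z‖ = 1) {k l : ℕ} (hkl : k ≠ l) :
    p k = 0 ∨ p l = 0 := by
  by_contra! hne
  obtain ⟨hk, hl⟩ := hne
  -- The maximum with 1 guarantees a positive bound.
  set B := max C 1
  have hB0 : 0 < B := lt_of_lt_of_le one_pos (le_max_right _ _)
  have hunit : ∀ θ τ : ℝ, ‖circlePoint θ * circlePoint τ‖ = 1 := fun θ τ => by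
    rw [norm_mul, norm_circlePoint, norm_circlePoint, one_mul]
  set u : ℝ → ℝ → ℂ := fun τ θ => powerSum p (circlePoint θ * circlePoint τ) *
    (starRingEnd ℂ) (powerSum p (circlePoint θ)) with hu
  have hu1 : ∀ τ θ, ‖u τ θ‖ = 1 := fun τ θ => by
    simp [hu, h1 _ (hunit θ τ), h1 _ (norm_circlePoint θ)]
  have hcont : ∀ τ, Continuous (u τ) := fun τ =>
    (continuous_powerSum_comp hp (by fun_prop) fun θ => (hunit θ τ).le).mul
      (Complex.continuous_conj.comp
        (continuous_powerSum_comp hp (by fun_prop) fun θ => (norm_circlePoint θ).le))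
  have hupow : ∀ n τ θ, u τ θ ^ n = powerSum (c n) (circlePoint θ * circlePoint τ) *
      (starRingEnd ℂ) (powerSum (c n) (circlePoint θ)) := fun n τ θ => by
    rw [hpow _ _ (hunit θ τ), hpow _ _ (norm_circlePoint θ), hu, mul_pow, map_pow]
  have h4 := fun n => one_div_le_tsum_norm_pow_four (hs n) hB0 ((hC n).trans (le_max_left _ _))
    fun θ => by rw [hpow _ _ (norm_circlePoint θ), norm_pow, h1 _ (norm_circlePoint θ), one_pow]
  have hlev : ∀ τ, circlePoint τ ^ k ≠ circlePoint τ ^ l →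
      ∀ y, ∀ᵐ θ ∂arcMeasure, u τ θ ≠ u τ y := by
    intro τ hτ y
    by_contra hcon
    have hE : MeasurableSet {θ | u τ θ = u τ y} :=
      (isClosed_eq (hcont τ) continuous_const).measurableSet
    have hμ : arcMeasure {θ | u τ θ = u τ y} ≠ 0 := fun h0 => hcon (by
      rw [ae_iff]; simpa using h0)
    -- These are the coefficients of `p(z e^{iτ}) - u τ y * p(z)`, which vanishes on the level set.
    -- If that set had positive measure, they would all be 0, and `m = k, l` would force `e^{ikτ} =
    -- u τ y = e^{ilτ}`.
    have hq : Summable fun m => ‖p m * (circlePoint τ ^ m - u τ y)‖ := by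
      refine (hp.mul_right 2).of_nonneg_of_le (fun _ => norm_nonneg _) fun m => ?_
      rw [norm_mul]
      gcongr
      refine (norm_sub_le _ _).trans ?_
      rw [norm_pow, norm_circlePoint, hu1]; norm_num
    have hz := eq_zero_of_powerSum_vanish hq hE hμ fun θ hθ => by
      have e1 := hasSum_powerSum hp (hunit θ τ).le
      have e2 := (hasSum_powerSum hp (norm_circlePoint θ).le).mul_left (u τ y)
      have e3 := (e1.sub e2).tsum_eq
      have e4 : powerSum p (circlePoint θ * circlePoint τ) - u τ y * powerSum p (circlePoint θ)
          = 0 := by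
        rw [← (show u τ θ = u τ y from hθ), hu]
        simp only
        rw [mul_assoc, mul_comm ((starRingEnd ℂ) _), Complex.mul_conj', h1 _ (norm_circlePoint θ)]
        simp
      rw [e4] at e3
      rw [← e3, powerSum]
      refine tsum_congr fun m => ?_
      rw [mul_pow]; ring
    have hzk := (mul_eq_zero.1 (congrFun hz k)).resolve_left hk
    have hzl := (mul_eq_zero.1 (congrFun hz l)).resolve_left hl
    exact hτ ((sub_eq_zero.1 hzk).trans (sub_eq_zero.1 hzl).symm)
  set F : ℕ → ℝ → ℝ := fun n τ => ‖∫ θ, u τ θ ^ n ∂arcMeasure‖ ^ 2 with hF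
  have hFcont : ∀ n, Continuous (F n) := fun n => by
    have hq := summable_norm_normSq (hs n)
    simp only [hF, hupow, integral_powerSum_autocorrelation (hs n) (norm_circlePoint _)]
    exact ((continuous_const.mul (continuous_powerSum_comp hq (by fun_prop)
      fun τ => (norm_circlePoint τ).le)).norm).pow 2
  have hFbd : ∀ n τ, F n τ ≤ (2 * Real.pi) ^ 2 := fun n τ => by
    have : ‖∫ θ, u τ θ ^ n ∂arcMeasure‖ ≤ 2 * Real.pi :=
      (norm_integral_le_of_norm_le_const (C := 1)
        (Eventually.of_forall fun x => by simp [hu1])).trans (by rw [arcMeasure_real_univ, one_mul])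
    exact pow_le_pow_left₀ (norm_nonneg _) this 2
  have hF0 : ∀ n τ, 0 ≤ F n τ := fun n τ => sq_nonneg _
  have hFint : ∀ n, ∫ τ, F n τ ∂arcMeasure = (2 * Real.pi) ^ 3 * ∑' k, ‖c n k‖ ^ 4 := fun n => by
    simp only [hF, hupow]
    exact integral_normSq_autocorrelation (hs n)
  have hlim := tendsto_integral_of_dominated_convergence (μ := arcMeasure)
    (fun _ => (2 * Real.pi) ^ 2)
    (F := fun (N : ℕ) τ => (N : ℝ)⁻¹ * ∑ n ∈ Finset.range N, F n τ) (f := fun _ => 0)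
    (fun N => (continuous_const.mul
      (continuous_finsetSum _ fun n _ => hFcont n)).aestronglyMeasurable)
    (integrable_const _)
    (fun N => Eventually.of_forall fun τ => by
      have := norm_average_le (N := N) (f := fun n => (F n τ : ℂ)) (sq_nonneg (2 * Real.pi))
        fun n => by
          rw [Complex.norm_real, Real.norm_eq_abs, abs_of_nonneg (hF0 n τ)]; exact hFbd n τ
      rw [← Complex.norm_real]
      push_cast
      exact this)
    (by
      filter_upwards [ae_circlePoint_pow_ne hkl] with τ hτ
      exact tendsto_average_normSq_integral_pow (hcont τ).measurable (hu1 τ) (hlev τ hτ))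
  -- The `ℓ⁴` bound keeps every average above a fixed positive number, against the limit 0.
  have hval : ∀ N : ℕ, 0 < N → (2 * Real.pi) ^ 3 * (1 / (8 * B ^ 2))
      ≤ ∫ τ, (N : ℝ)⁻¹ * ∑ n ∈ Finset.range N, F n τ ∂arcMeasure := fun N hN => by
    have hN' : (0 : ℝ) < N := by exact_mod_cast hN
    rw [integral_const_mul, integral_finsetSum _ fun n _ => (hFcont n).integrableOn_Ioc,
      inv_mul_eq_div, le_div_iff₀ hN']
    simp only [hFint]
    have := Finset.card_nsmul_le_sum (Finset.range N)
      (fun n => (2 * Real.pi) ^ 3 * ∑' k, ‖c n k‖ ^ 4) ((2 * Real.pi) ^ 3 * (1 / (8 * B ^ 2)))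
      fun n _ => mul_le_mul_of_nonneg_left (h4 n) (by positivity)
    rw [Finset.card_range, nsmul_eq_mul] at this
    linarith
  rw [integral_zero] at hlim
  have hle := ge_of_tendsto hlim ((eventually_gt_atTop 0).mono hval)
  have : 0 < (2 * Real.pi) ^ 3 * (1 / (8 * B ^ 2)) := by have := Real.pi_pos; positivity
  linarith

/-! ### The Wiener algebra as a Banach space, and boundedness of `C_φ`. -/

namespace WienerAlgebra

theorem ext_toFun {f g : WienerAlgebra} (h : ∀ z, f.toFun z = g.toFun z) : f = g :=
  Subtype.ext (funext h)

theorem norm_toFun_le (f : WienerAlgebra) (z : ClosedPolydisc) : ‖f.toFun z‖ ≤ ‖f‖ := by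
  have hf := f.hasWienerExpansion
  rw [← (hf.2 z).tsum_eq]
  refine (norm_tsum_le_tsum_norm (hf.summable_mul_monomial z)).trans ?_
  refine (hf.summable_mul_monomial z).tsum_le_tsum (fun α => ?_) hf.1
  rw [norm_mul]
  exact mul_le_of_le_one_right (norm_nonneg _) (norm_polyMonomial_le α z)

theorem toFun_smul (c : ℂ) (f : WienerAlgebra) (z : ClosedPolydisc) :
    (c • f).toFun z = c * f.toFun z := rfl

/-- An absolutely summable family of Taylor coefficients defines an element of the algebra. -/
def ofCoeff (a : (ℕ →₀ ℕ) → ℂ) (ha : Summable fun α => ‖a α‖) : WienerAlgebra :=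
  ⟨fun z => ∑' α, a α * polyMonomial α z, a, ha, fun z =>
    (Summable.of_norm_bounded ha fun α => by
      rw [norm_mul]
      exact mul_le_of_le_one_right (norm_nonneg _) (norm_polyMonomial_le α z)).hasSum⟩

theorem coeff_ofCoeff (a : (ℕ →₀ ℕ) → ℂ) (ha : Summable fun α => ‖a α‖) :
    (ofCoeff a ha).coeff = a :=
  coeff_eq _ ⟨ha, fun z => (Summable.of_norm_bounded ha fun α => by
      rw [norm_mul]
      exact mul_le_of_le_one_right (norm_nonneg _) (norm_polyMonomial_le α z)).hasSum⟩

/-- Taking Taylor coefficients embeds the Wiener algebra isometrically into `ℓ¹`. -/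
def coeffLp : WienerAlgebra →ₗᵢ[ℂ] lp (fun _ : ℕ →₀ ℕ => ℂ) 1 where
  toFun f := ⟨f.coeff, memℓp_gen (by simpa using f.hasWienerExpansion.1)⟩
  map_add' f g := Subtype.ext (coeff_add f g)
  map_smul' c f := Subtype.ext (coeff_smul c f)
  norm_map' f := by
    rw [lp.norm_eq_tsum_rpow (by simp)]
    simp [norm_def]

theorem coeffLp_surjective : Function.Surjective coeffLp := fun a =>
  ⟨ofCoeff a (by simpa using (lp.memℓp a).summable (by simp)), Subtype.ext (coeff_ofCoeff _ _)⟩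

/-- Completeness is what the closed graph theorem requires. -/
instance : CompleteSpace WienerAlgebra := by
  refine coeffLp.isometry.isUniformInducing.completeSpace ?_
  rw [coeffLp_surjective.range_eq]
  exact isComplete_univ

/-- The monomial `z^β` as an element of the Wiener algebra. -/
def monomial (β : ℕ →₀ ℕ) : WienerAlgebra :=
  ofCoeff (Pi.single β 1) (summable_of_ne_finset_zero (s := {β}) fun α hα => by simp_all)

theorem coeff_monomial (β : ℕ →₀ ℕ) : (monomial β).coeff = Pi.single β 1 := coeff_ofCoeff _ _

theorem toFun_monomial (β : ℕ →₀ ℕ) (z : ClosedPolydisc) :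
    (monomial β).toFun z = polyMonomial β z := by
  change ∑' α, (Pi.single β 1 : (ℕ →₀ ℕ) → ℂ) α * polyMonomial α z = _
  rw [tsum_eq_single β fun α hα => by simp [hα]]
  simp

theorem norm_monomial (β : ℕ →₀ ℕ) : ‖monomial β‖ = 1 := by
  rw [norm_def, coeff_monomial, tsum_eq_single β fun α hα => by simp [hα]]
  simp

end WienerAlgebra

open WienerAlgebra

/-- Composition operators on the Wiener algebra are bounded, by the closed graph theorem. -/
theorem continuous_compositionOperator (φ : ClosedPolydisc → ClosedPolydisc)
    (hφ : InducesCompositionOperator φ) : Continuous (compositionOperator φ hφ) := by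
  refine LinearMap.continuous_of_seq_closed_graph _ fun u f g hu hg => ext_toFun fun z => ?_
  -- Point evaluations are continuous, so both limits are identified pointwise.
  have heval : ∀ (v : ℕ → WienerAlgebra) (h : WienerAlgebra) (x : ClosedPolydisc),
      Filter.Tendsto v Filter.atTop (nhds h) →
      Filter.Tendsto (fun n => (v n).toFun x) Filter.atTop (nhds (h.toFun x)) := by
    intro v h x hv
    rw [tendsto_iff_norm_sub_tendsto_zero] at hv ⊢
    exact squeeze_zero (fun _ => norm_nonneg _) (fun n => norm_toFun_le (v n - h) x) hv
  exact tendsto_nhds_unique (heval _ g z hg) (heval _ f (φ z) hu)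

theorem exists_norm_compositionOperator_le (φ : ClosedPolydisc → ClosedPolydisc)
    (hφ : InducesCompositionOperator φ) : ∃ C, ∀ f, ‖compositionOperator φ hφ f‖ ≤ C * ‖f‖ :=
  let T : WienerAlgebra →L[ℂ] WienerAlgebra :=
    ⟨compositionOperator φ hφ, continuous_compositionOperator φ hφ⟩
  ⟨‖T‖, T.le_opNorm⟩

/-! ### Slices in one coordinate and the Beurling–Helson theorem on the infinite torus. -/

/-- Multiplication of the `j`-th coordinate by `c`. -/
def scaleCoord (j : ℕ) (c : ℂ) (hc : ‖c‖ ≤ 1) (z : ClosedPolydisc) : ClosedPolydisc :=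
  Function.update z j ⟨c * z j, by
    rw [mem_closedBall_zero_iff, norm_mul]
    exact mul_le_one₀ hc (norm_nonneg _) (mem_closedBall_zero_iff.1 (z j).2)⟩

theorem polyMonomial_scaleCoord (α : ℕ →₀ ℕ) (j : ℕ) (c : ℂ) (hc : ‖c‖ ≤ 1)
    (z : ClosedPolydisc) :
    polyMonomial α (scaleCoord j c hc z) = c ^ α j * polyMonomial α z := by
  unfold polyMonomial
  rw [← Finsupp.mul_prod_erase' α j _ fun _ => pow_zero _,
    ← Finsupp.mul_prod_erase' α j (fun i n => (z i : ℂ) ^ n) fun _ => pow_zero _, ← mul_assoc,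
    ← mul_pow]
  congr 1
  · simp [scaleCoord]
  · refine Finsupp.prod_congr fun i hi => ?_
    have : i ≠ j := by rintro rfl; simp at hi
    simp [scaleCoord, this]

theorem scaleCoord_mem_infiniteTorus {j : ℕ} {c : ℂ} (hc : ‖c‖ = 1) {z : ClosedPolydisc}
    (hz : z ∈ infiniteTorus) : scaleCoord j c hc.le z ∈ infiniteTorus := by
  intro i
  rcases eq_or_ne i j with rfl | h
  · simp [scaleCoord, hc, hz i]
  · simp [scaleCoord, h, hz i]

/-- The coefficients of `z^α` in a Taylor series for those `α` with `α_j = k`. -/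
def restrictExponent (a : (ℕ →₀ ℕ) → ℂ) (j k : ℕ) (α : ℕ →₀ ℕ) : ℂ := if α j = k then a α else 0

theorem norm_restrictExponent_le (a : (ℕ →₀ ℕ) → ℂ) (j k : ℕ) (α : ℕ →₀ ℕ) :
    ‖restrictExponent a j k α‖ ≤ ‖a α‖ := by
  unfold restrictExponent; split_ifs <;> simp

/-- The coefficient of `λ^k` in the power series of `λ ↦ f (z_0, …, λ z_j, …)`. -/
def sliceCoeff (a : (ℕ →₀ ℕ) → ℂ) (j : ℕ) (z : ClosedPolydisc) (k : ℕ) : ℂ :=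
  ∑' α, restrictExponent a j k α * polyMonomial α z

theorem sliceCoeff_eq_tsum_fiber (a : (ℕ →₀ ℕ) → ℂ) (j : ℕ) (z : ClosedPolydisc) (k : ℕ) :
    sliceCoeff a j z k
      = ∑' α : (fun α : ℕ →₀ ℕ => α j) ⁻¹' {k}, a α * polyMonomial (α : ℕ →₀ ℕ) z := by
  rw [tsum_subtype ((fun α : ℕ →₀ ℕ => α j) ⁻¹' {k}) fun α => a α * polyMonomial α z, sliceCoeff]
  refine tsum_congr fun α => ?_
  by_cases h : α j = k <;> simp [restrictExponent, Set.indicator, h]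

section Slices

variable {a : (ℕ →₀ ℕ) → ℂ} {f : ClosedPolydisc → ℂ}

/-- Grouping the series by the exponent of `z_j` cannot increase the sum of norms, so one bound on
the powers serves all slices. -/
theorem summable_norm_sliceCoeff (hf : HasWienerExpansion a f) (j : ℕ) (z : ClosedPolydisc) :
    (Summable fun k => ‖sliceCoeff a j z k‖) ∧ ∑' k, ‖sliceCoeff a j z k‖ ≤ ∑' α, ‖a α‖ := by
  have h1 := (hf.summable_mul_monomial z).hasSum.tsum_fiberwise fun α : ℕ →₀ ℕ => α j
  have hle : ∀ k, ‖sliceCoeff a j z k‖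
      ≤ ∑' α : (fun α : ℕ →₀ ℕ => α j) ⁻¹' {k}, ‖a α * polyMonomial (α : ℕ →₀ ℕ) z‖ := fun k => by
    rw [sliceCoeff_eq_tsum_fiber]
    exact norm_tsum_le_tsum_norm ((hf.summable_mul_monomial z).subtype _)
  have hs := h1.summable.of_nonneg_of_le (fun _ => norm_nonneg _) hle
  refine ⟨hs, (hs.tsum_le_tsum hle h1.summable).trans ?_⟩
  rw [h1.tsum_eq]
  refine (hf.summable_mul_monomial z).tsum_le_tsum (fun α => ?_) hf.1
  rw [norm_mul]
  exact mul_le_of_le_one_right (norm_nonneg _) (norm_polyMonomial_le α z)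

theorem powerSum_sliceCoeff (hf : HasWienerExpansion a f) (j : ℕ) (z : ClosedPolydisc) (c : ℂ)
    (hc : ‖c‖ ≤ 1) : powerSum (sliceCoeff a j z) c = f (scaleCoord j c hc z) := by
  rw [powerSum, ← ((hf.2 (scaleCoord j c hc z)).tsum_fiberwise fun α : ℕ →₀ ℕ => α j).tsum_eq]
  refine tsum_congr fun k => ?_
  rw [sliceCoeff_eq_tsum_fiber, ← tsum_mul_right]
  refine tsum_congr fun α => ?_
  have hα : (α : ℕ →₀ ℕ) j = k := α.2
  rw [polyMonomial_scaleCoord, hα]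
  ring

open HasWienerExpansion

theorem continuous_sliceCoeff_torusPoint (ha : Summable fun α => ‖a α‖) (j k : ℕ) :
    Continuous fun w => sliceCoeff a j (torusPoint w) k := by
  refine continuous_tsum (fun α => continuous_const.mul (continuous_polyMonomial_point α)) ha
    fun α w => ?_
  rw [norm_mul, norm_polyMonomial_point, mul_one]
  exact norm_restrictExponent_le a j k α

theorem torusPoint_mem_infiniteTorus (w : ℕ → Circle) : torusPoint w ∈ infiniteTorus := fun j =>
  Circle.norm_coe (w j)

/-- Distinct monomials are orthogonal on the infinite torus. -/
theorem integral_polyMonomial_mul_conj [MeasurableSpace (ℕ → Circle)] [BorelSpace (ℕ → Circle)]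
    (μ : Measure (ℕ → Circle)) [μ.IsMulLeftInvariant] {α β : ℕ →₀ ℕ} (h : β ≠ α) :
    ∫ w, polyMonomial β (torusPoint w) * (starRingEnd ℂ) (polyMonomial α (torusPoint w)) ∂μ
      = 0 := by
  -- Translation by `v` multiplies the integrand by a constant other than 1, while the integral is
  -- invariant.
  obtain ⟨v, hv⟩ := exists_point_ne h
  have hinv := integral_mul_left_eq_self (μ := μ) (fun w => polyMonomial β (torusPoint w) *
    (starRingEnd ℂ) (polyMonomial α (torusPoint w))) v
  have hmul : ∀ w, polyMonomial β (torusPoint (v * w)) *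
      (starRingEnd ℂ) (polyMonomial α (torusPoint (v * w)))
      = (polyMonomial β (torusPoint v) * (starRingEnd ℂ) (polyMonomial α (torusPoint v))) *
        (polyMonomial β (torusPoint w) * (starRingEnd ℂ) (polyMonomial α (torusPoint w))) := by
    intro w
    simp only [polyMonomial_mul_point, map_mul]
    ring
  simp only [hmul] at hinv
  rw [integral_const_mul] at hinv
  by_contra hne
  have h1 := mul_right_cancel₀ hne (hinv.trans (one_mul _).symm)
  have h2 : (starRingEnd ℂ) (polyMonomial α (torusPoint v)) * polyMonomial α (torusPoint v) = 1 := by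
    rw [mul_comm, Complex.mul_conj', norm_polyMonomial_point]; simp
  apply hv
  rw [← mul_one (polyMonomial β _), ← h2, ← mul_assoc, h1, one_mul]

/-- An absolutely convergent Taylor series vanishing on the infinite torus is zero. -/
theorem eq_zero_of_tsum_torusPoint_eq_zero (ha : Summable fun α => ‖a α‖)
    (h : ∀ w, ∑' α, a α * polyMonomial α (torusPoint w) = 0) : a = 0 := by
  funext α
  let _ : MeasurableSpace (ℕ → Circle) := borel _
  have _ : BorelSpace (ℕ → Circle) := ⟨rfl⟩
  let μ : Measure (ℕ → Circle) := Measure.haar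
  have hcont : ∀ β, Continuous fun w => a β * (polyMonomial β (torusPoint w) *
      (starRingEnd ℂ) (polyMonomial α (torusPoint w))) := fun β =>
    continuous_const.mul ((continuous_polyMonomial_point β).mul
      (Complex.continuous_conj.comp (continuous_polyMonomial_point α)))
  -- Integration against the conjugate of `z^α` isolates the coefficient `a α`.
  have hsum := hasSum_integral_of_summable_integral_norm (μ := μ)
    (F := fun β w => a β * (polyMonomial β (torusPoint w) *
      (starRingEnd ℂ) (polyMonomial α (torusPoint w))))
    (fun β => (hcont β).integrable_of_hasCompactSupport (HasCompactSupport.of_compactSpace _)) (by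
      simp only [norm_mul, norm_polyMonomial_point, RCLike.norm_conj, mul_one, integral_const,
        smul_eq_mul]
      exact ha.mul_left _)
  simp only [← mul_assoc, tsum_mul_right, h, zero_mul, integral_zero] at hsum
  simp only [mul_assoc, integral_const_mul] at hsum
  have h0 := (hasSum_single α fun β hβ => by
    rw [integral_polyMonomial_mul_conj μ hβ, mul_zero]).unique hsum
  simpa [Complex.mul_conj', norm_polyMonomial_point, measureReal_univ_ne_zero] using h0

/-- The several-variable Beurling–Helson theorem for absolutely convergent Taylor series: a
function that is unimodular on the torus and has powers of bounded norm is a monomial. -/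
theorem exists_eq_monomial_of_bounded_powers {f : WienerAlgebra} {F : ℕ → WienerAlgebra} {C : ℝ}
    (hF : ∀ n z, (F n).toFun z = f.toFun z ^ n) (hC : ∀ n, ‖F n‖ ≤ C)
    (h1 : ∀ z ∈ infiniteTorus, ‖f.toFun z‖ = 1) :
    ∃ (α : ℕ →₀ ℕ) (c : ℂ), ‖c‖ = 1 ∧ ∀ z, f.toFun z = c * polyMonomial α z := by
  have hf := f.hasWienerExpansion
  have hslice : ∀ j z, z ∈ infiniteTorus → ∀ c : ℂ, ‖c‖ = 1 →
      ‖powerSum (sliceCoeff f.coeff j z) c‖ = 1 := fun j z hz c hc => by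
    rw [powerSum_sliceCoeff hf j z c hc.le, h1 _ (scaleCoord_mem_infiniteTorus hc hz)]
  have hone : ∀ j z, z ∈ infiniteTorus → ∀ k l, k ≠ l →
      sliceCoeff f.coeff j z k = 0 ∨ sliceCoeff f.coeff j z l = 0 := fun j z hz k l hkl =>
    coeff_eq_zero_or_of_bounded_powers (c := fun n => sliceCoeff (F n).coeff j z)
      (fun n => (summable_norm_sliceCoeff (F n).hasWienerExpansion j z).1)
      (fun n => (summable_norm_sliceCoeff (F n).hasWienerExpansion j z).2.trans (hC n))
      (summable_norm_sliceCoeff hf j z).1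
      (fun n c hc => by
        rw [powerSum_sliceCoeff (F n).hasWienerExpansion j z c hc.le,
          powerSum_sliceCoeff hf j z c hc.le, hF])
      (hslice j z hz) hkl
  -- At most one slice coefficient is nonzero, so its modulus is that of the slice at 1.
  have hnorm : ∀ j z, z ∈ infiniteTorus → ∀ k, sliceCoeff f.coeff j z k ≠ 0 →
      ‖sliceCoeff f.coeff j z k‖ = 1 := fun j z hz k hk => by
    have h2 := hslice j z hz 1 norm_one
    rwa [powerSum, tsum_eq_single k fun l hl => by
      rw [(hone j z hz l k hl).resolve_right hk, zero_mul], one_pow, mul_one] at h2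
  have hvanish : ∀ j k, (∀ w, sliceCoeff f.coeff j (torusPoint w) k = 0) →
      ∀ α : ℕ →₀ ℕ, α j = k → f.coeff α = 0 := fun j k hw α hα => by
    have := congrFun (eq_zero_of_tsum_torusPoint_eq_zero
      (hf.1.of_nonneg_of_le (fun _ => norm_nonneg _) (norm_restrictExponent_le f.coeff j k)) hw) α
    simpa [restrictExponent, hα] using this
  have hpair : ∀ α β, α ≠ β → f.coeff α = 0 ∨ f.coeff β = 0 := by
    intro α β hαβ
    obtain ⟨j, hj⟩ := DFunLike.ne_iff.1 hαβ
    have hcont := continuous_sliceCoeff_torusPoint hf.1 j (α j)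
    -- The modulus takes only the values 0 and 1, so vanishing is the open condition of being less
    -- than 1 in modulus.
    have hclopen : IsClopen {w | sliceCoeff f.coeff j (torusPoint w) (α j) = 0} := by
      refine ⟨isClosed_eq hcont continuous_const, ?_⟩
      convert isOpen_lt hcont.norm (continuous_const (y := (1 : ℝ))) using 1
      ext w
      refine ⟨fun h => ?_, fun h => ?_⟩
      · simp only [Set.mem_ofPred_eq] at h ⊢
        rw [h, norm_zero]; exact one_pos
      · by_contra hne
        exact h.ne (hnorm j _ (torusPoint_mem_infiniteTorus w) _ hne)
    -- By connectedness the coefficient of exponent `α j` vanishes nowhere or everywhere; in the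
    -- first case that of exponent `β j` vanishes everywhere.
    rcases isClopen_iff.1 hclopen with h | h
    · refine Or.inr (hvanish j (β j) (fun w => ?_) β rfl)
      refine (hone j _ (torusPoint_mem_infiniteTorus w) _ _ hj).resolve_left fun h0 => ?_
      have : w ∈ (∅ : Set (ℕ → Circle)) := h ▸ h0
      exact this
    · exact Or.inl (hvanish j (α j) (fun w => (h.symm ▸ Set.mem_univ w :
        w ∈ {w | sliceCoeff f.coeff j (torusPoint w) (α j) = 0})) α rfl)
  have hex : ∃ α, f.coeff α ≠ 0 := by
    by_contra! h0
    have h2 := h1 _ (torusPoint_mem_infiniteTorus 1)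
    rw [← (hf.2 _).tsum_eq] at h2
    simp [h0] at h2
  obtain ⟨α, hα⟩ := hex
  have hmon : ∀ z, f.toFun z = f.coeff α * polyMonomial α z := fun z =>
    (hf.2 z).unique (hasSum_single α fun β hβ => by
      rw [(hpair β α hβ).resolve_right hα, zero_mul])
  refine ⟨α, f.coeff α, ?_, hmon⟩
  have h2 := h1 _ (torusPoint_mem_infiniteTorus 1)
  rwa [hmon, norm_mul, norm_polyMonomial_point, mul_one] at h2

end Slices

/-! ### The monomial form of `φ`. -/

theorem polyMonomial_single (i n : ℕ) (z : ClosedPolydisc) :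
    polyMonomial (Finsupp.single i n) z = (z i : ℂ) ^ n := by
  simp [polyMonomial]

/-- The power `φ_i^n` is the image of `z_i^n`, which has norm 1, so a bound for `C_φ` bounds all
these powers. -/
theorem exists_hasMonomialForm (φ : ClosedPolydisc → ClosedPolydisc)
    (hφ : InducesCompositionOperator φ) (hT : ∀ z ∈ infiniteTorus, φ z ∈ infiniteTorus) :
    ∃ (A : ℕ → ℕ →₀ ℕ) (ε : ℕ → ℂ), HasMonomialForm φ A ε := by
  obtain ⟨C, hC⟩ := exists_norm_compositionOperator_le φ hφ
  have hpow : ∀ i n z, (compositionOperator φ hφ (monomial (Finsupp.single i n))).toFun z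
      = (φ z i : ℂ) ^ n := fun i n z => by
    rw [compositionOperator_toFun, toFun_monomial, polyMonomial_single]
  have key : ∀ i, ∃ (α : ℕ →₀ ℕ) (c : ℂ), ‖c‖ = 1 ∧ ∀ z, (φ z i : ℂ) = c * polyMonomial α z := by
    intro i
    have hone : ∀ z, (compositionOperator φ hφ (monomial (Finsupp.single i 1))).toFun z
        = (φ z i : ℂ) := fun z => by rw [hpow, pow_one]
    have := exists_eq_monomial_of_bounded_powers
      (f := compositionOperator φ hφ (monomial (Finsupp.single i 1)))
      (F := fun n => compositionOperator φ hφ (monomial (Finsupp.single i n))) (C := C)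
      (fun n z => by rw [hpow, hone])
      (fun n => (hC _).trans (by rw [norm_monomial, mul_one]))
      (fun z hz => by rw [hone]; exact hT z hz i)
    simpa only [hone] using this
  choose A ε hε hA using key
  exact ⟨A, ε, hε, fun z i => hA i z⟩

/-! ### The transpose on natural and on integer exponents. -/

/-- The transpose of a row-finite matrix acting on finitely supported sequences of nonnegative
integers. -/
def transposeActionNat (A : ℕ → ℕ →₀ ℕ) (α : ℕ →₀ ℕ) : ℕ →₀ ℕ := α.sum fun i n => n • A i

/-- The coordinatewise inclusion of `ℕ` in `ℤ` on finitely supported sequences. -/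
def natToInt : (ℕ →₀ ℕ) →+ (ℕ →₀ ℤ) := Finsupp.mapRange.addMonoidHom (Nat.castAddMonoidHom ℤ)

theorem natToInt_apply (α : ℕ →₀ ℕ) (i : ℕ) : natToInt α i = (α i : ℤ) := rfl

theorem natToInt_injective : Function.Injective natToInt := fun α β h => by
  ext i
  exact Int.ofNat_inj.1 (DFunLike.congr_fun h i)

section Transpose

variable (A : ℕ → ℕ →₀ ℕ)

theorem transposeActionNat_add (α β : ℕ →₀ ℕ) :
    transposeActionNat A (α + β) = transposeActionNat A α + transposeActionNat A β :=
  Finsupp.sum_add_index' (fun _ => zero_smul _ _) fun _ _ _ => add_smul _ _ _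

theorem transposeAction_add (α β : ℕ →₀ ℤ) :
    transposeAction A (α + β) = transposeAction A α + transposeAction A β :=
  Finsupp.sum_add_index' (fun _ => zero_smul _ _) fun _ _ _ => add_smul _ _ _

theorem transposeAction_natToInt (α : ℕ →₀ ℕ) :
    transposeAction A (natToInt α) = natToInt (transposeActionNat A α) := by
  rw [transposeActionNat, Finsupp.sum, map_sum]
  simp only [map_nsmul]
  have : transposeAction A (natToInt α) = α.sum fun i n => (n : ℤ) • natToInt (A i) :=
    Finsupp.sum_mapRange_index (hf := map_zero _) fun _ => zero_smul _ _
  rw [this, Finsupp.sum]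
  simp only [natCast_zsmul]

theorem exists_add_natToInt_eq (α : ℕ →₀ ℤ) : ∃ p q, α + natToInt q = natToInt p := by
  refine ⟨α.mapRange Int.toNat rfl, (-α).mapRange Int.toNat rfl, ?_⟩
  ext i
  simp only [Finsupp.add_apply, natToInt_apply, Finsupp.mapRange_apply, Finsupp.neg_apply]
  omega

/-- Every integer sequence is a difference of two natural ones, so an integer collision becomes a
natural one after moving negative parts across. -/
theorem transposeAction_injective_iff :
    Function.Injective (transposeAction A) ↔ Function.Injective (transposeActionNat A) := by
  constructor
  · intro h α β hαβ
    apply natToInt_injective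
    apply h
    rw [transposeAction_natToInt, transposeAction_natToInt, hαβ]
  · intro h α β hαβ
    obtain ⟨p, q, hpq⟩ := exists_add_natToInt_eq α
    obtain ⟨r, s, hrs⟩ := exists_add_natToInt_eq β
    have h1 : p + s = r + q := by
      apply h
      apply natToInt_injective
      simp only [← transposeAction_natToInt, map_add, transposeAction_add, ← hpq, ← hrs, hαβ]
      abel
    have h2 := congrArg natToInt h1
    rw [map_add, map_add, ← hpq, ← hrs] at h2
    have h3 : α + (natToInt q + natToInt s) = β + (natToInt q + natToInt s) := by
      rw [← add_assoc, h2]; abel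
    exact add_right_cancel h3

end Transpose

/-! ### The isometry criterion. -/

section MonomialForm

variable {φ : ClosedPolydisc → ClosedPolydisc} {A : ℕ → ℕ →₀ ℕ} {ε : ℕ → ℂ}

theorem polyMonomial_comp (h : HasMonomialForm φ A ε) (α : ℕ →₀ ℕ) (z : ClosedPolydisc) :
    polyMonomial α (φ z)
      = (α.prod fun i n => ε i ^ n) * polyMonomial (transposeActionNat A α) z := by
  have hsmul : ∀ (n : ℕ) (γ : ℕ →₀ ℕ), polyMonomial (n • γ) z = polyMonomial γ z ^ n := by
    intro n γ
    induction n with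
    | zero => simp [polyMonomial]
    | succ n ih => rw [succ_nsmul, polyMonomial_add, ih, pow_succ]
  induction α using Finsupp.induction_linear with
  | zero => simp [polyMonomial, transposeActionNat]
  | add α β hα hβ =>
    rw [polyMonomial_add, hα, hβ, transposeActionNat_add, polyMonomial_add,
      Finsupp.prod_add_index' (fun _ => pow_zero _) fun _ _ _ => pow_add _ _ _]
    ring
  | single i n =>
    rw [polyMonomial_single, h.2 z i, mul_pow, Finsupp.prod_single_index (h := fun i n => ε i ^ n) (pow_zero _),
      transposeActionNat, Finsupp.sum_single_index (h := fun i n => n • A i) (zero_smul _ _), hsmul]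
    rfl

theorem norm_prod_pow_eq_one (h : HasMonomialForm φ A ε) (α : ℕ →₀ ℕ) :
    ‖α.prod fun i n => ε i ^ n‖ = 1 := by
  simp [Finsupp.prod, norm_prod, h.1]

/-- Distinct monomials have images with distinct exponents, so coefficients are only relocated and
multiplied by unimodular constants; none merge. -/
theorem norm_compositionOperator_of_injective (h : HasMonomialForm φ A ε)
    (hφ : InducesCompositionOperator φ) (hA : Function.Injective (transposeActionNat A))
    (f : WienerAlgebra) : ‖compositionOperator φ hφ f‖ = ‖f‖ := by
  have hf := f.hasWienerExpansion
  set b : (ℕ →₀ ℕ) → ℂ := Function.extend (transposeActionNat A)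
    (fun α => f.coeff α * α.prod fun i n => ε i ^ n) 0
  have hb : ∀ α, b (transposeActionNat A α) = f.coeff α * α.prod fun i n => ε i ^ n := fun α =>
    hA.extend_apply _ _ _
  have hb0 : ∀ β, β ∉ Set.range (transposeActionNat A) → b β = 0 := fun β hβ =>
    Function.extend_apply' _ _ _ hβ
  have hnb : ∀ α, ‖b (transposeActionNat A α)‖ = ‖f.coeff α‖ := fun α => by
    rw [hb, norm_mul, norm_prod_pow_eq_one h, mul_one]
  have hn : HasSum (fun β => ‖b β‖) ‖f‖ := by
    rw [← hA.hasSum_iff fun β hβ => by rw [hb0 β hβ, norm_zero]]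
    simp only [Function.comp_def, hnb]
    exact hf.1.hasSum
  have hexp : HasWienerExpansion b (compositionOperator φ hφ f).toFun := by
    refine ⟨hn.summable, fun z => ?_⟩
    rw [← hA.hasSum_iff fun β hβ => by rw [hb0 β hβ, zero_mul]]
    simp only [Function.comp_def, hb, compositionOperator_toFun]
    refine (hf.2 (φ z)).congr_fun fun α => ?_
    rw [polyMonomial_comp h, mul_assoc]
  rw [norm_def, coeff_eq _ hexp, hn.tsum_eq]

theorem transposeActionNat_injective (h : HasMonomialForm φ A ε)
    (hφ : InducesCompositionOperator φ)
    (hinj : Function.Injective (compositionOperator φ hφ)) :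
    Function.Injective (transposeActionNat A) := by
  intro α β hαβ
  have hne : ∀ γ : ℕ →₀ ℕ, (γ.prod fun i n => ε i ^ n) ≠ 0 := fun γ h0 => by
    have := norm_prod_pow_eq_one h γ
    simp [h0] at this
  -- Each monomial carries the constant arising from the other, so that the two images coincide.
  have heq : (β.prod fun i n => ε i ^ n) • monomial α
      = (α.prod fun i n => ε i ^ n) • monomial β := by
    apply hinj
    refine ext_toFun fun z => ?_
    simp only [compositionOperator_toFun, toFun_smul, toFun_monomial, polyMonomial_comp h, hαβ]
    ring
  by_contra hcon
  have hc := congrFun (congrArg coeff heq) α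
  simp only [coeff_smul, coeff_monomial, Pi.smul_apply, Pi.single_eq_same,
    Pi.single_eq_of_ne hcon, smul_eq_mul, mul_one, mul_zero] at hc
  exact hne β hc

theorem isometry_compositionOperator_iff (h : HasMonomialForm φ A ε)
    (hφ : InducesCompositionOperator φ) :
    Isometry (compositionOperator φ hφ) ↔ Function.Injective (transposeAction A) := by
  rw [transposeAction_injective_iff]
  exact ⟨fun hi => transposeActionNat_injective h hφ hi.injective, fun hA =>
    AddMonoidHomClass.isometry_of_norm _ (norm_compositionOperator_of_injective h hφ hA)⟩

end MonomialForm

end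

theorem theorem4p4 (φ : ClosedPolydisc → ClosedPolydisc)
    (hφ : InducesCompositionOperator φ)
    (hT : ∀ z ∈ infiniteTorus, φ z ∈ infiniteTorus) :
    (∃ (A : ℕ → ℕ →₀ ℕ) (ε : ℕ → ℂ), HasMonomialForm φ A ε) ∧
      ∀ (A : ℕ → ℕ →₀ ℕ) (ε : ℕ → ℂ), HasMonomialForm φ A ε →
        (Isometry (compositionOperator φ hφ) ↔ Function.Injective (transposeAction A)) :=
  ⟨exists_hasMonomialForm φ hφ hT, fun _ _ h => isometry_compositionOperator_iff h hφ⟩
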